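/- All graphs are finite and simple. For an integer $k\ge 0$, a graph $G=(V,E)$ is a *$k$-threshold graph* if there are real numbers $\theta_1<\theta_2<\dots<\theta_k$ and a function $r:V\to\mathbb R$ such that for any two distinct vertices $u,v\in V$, we have $uv\in E$ if and only if $r(u)+r(v)\ge\theta_i$ holds for an odd number of indices $i\in\{1,\dots,k\}$. The *threshold number* $\Theta(G)$ is the smallest integer $k\ge 0$ such that $G$ is a $k$-threshold graph. For nonnegative integers $n_1,\dots,n_t$, let $\bigcup_{s=1}^t n_sK_s$ be the disjoint union of complete graphs (clusters) that has exactly $n_s$ clusters with $s$ vertices for each $1\le s\le t$. Let $q_m=m+\binom m3+1$. Let $n_1,\dots,n_t$ be nonnegative integers with $\sum_{i=1}^t n_i\ge 1$. (I) If $\sum_{j=3}^t n_j\le 1$, then $$\Theta\Big(\bigcup_{s=1}^t n_sK_s\Big)=\begin{cases}0 & \text{if } \sum_{k=2}^t n_k=0,\\ 1 & \text{if } \sum_{k=2}^t n_k=1,\\ 2 & \text{if } \sum_{k=2}^t n_k\ge 2.\end{cases}$$ (II) If $\sum_{j=3}^t n_j\ge 2$, then for every integer $m\ge 1$ with $\sum_{\ell=4}^t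 n_\ell\le m$, $$\Theta\Big(\bigcup_{s=1}^t n_sK_s\Big)=\begin{cases}2m-1 & \text{if } \sum_{j=3}^t n_j=q_{m-1},\\ 2m & \text{if } q_{m-1}+1\le \sum_{j=3}^t n_j\le q_m-1.\end{cases}$$ -/

import Mathlib

/-- `IsRepresentation G θ r`: the rank assignment `r` is a `(θ₁, …, θₖ)`-representation of `G`, where
`θ₁ < θ₂ < … < θₖ`: two distinct vertices `u`, `v` are adjacent if and only if
`r u + r v ≥ θᵢ` holds for an odd number of the thresholds. -/
def IsRepresentation {V : Type*} (G : SimpleGraph V) {k : ℕ} (θ : Fin k → ℝ) (r : V → ℝ) : Prop :=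
  StrictMono θ ∧ ∀ u v : V, u ≠ v →
    (G.Adj u v ↔ Odd (Finset.univ.filter (fun i : Fin k => θ i ≤ r u + r v)).card)

/-- `G` is a `k`-threshold graph (`k = 0` is allowed, and describes the graphs with no edge). -/
def IsKThresholdGraph {V : Type*} (G : SimpleGraph V) (k : ℕ) : Prop :=
  ∃ (θ : Fin k → ℝ) (r : V → ℝ), IsRepresentation G θ r

/-- The threshold number `Θ(G)`: the smallest `k` such that `G` is a `k`-threshold graph.
For finite graphs such a `k` exists, see `exists_isKThresholdGraph`. -/
noncomputable def thresholdNumber {V : Type*} (G : SimpleGraph V) : ℕ :=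
  sInf {k : ℕ | IsKThresholdGraph G k}

/-- Every finite graph is a `k`-threshold graph for some `k`. -/
theorem exists_isKThresholdGraph {V : Type*} [Finite V] (G : SimpleGraph V) :
    ∃ k : ℕ, IsKThresholdGraph G k := by
  classical
  obtain ⟨N, ⟨e⟩⟩ := Finite.exists_equiv_fin V
  let f : V → ℕ := fun v => 2 ^ (e v : ℕ)
  have hf : ∀ u v x y : V, u ≠ v → x ≠ y → f u + f v = f x + f y →
      (u = x ∧ v = y) ∨ (u = y ∧ v = x) := by
    intro u v x y huv hxy h
    have huv' : (e u : ℕ) ≠ e v := fun h => huv (e.injective (Fin.ext h))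
    have hxy' : (e x : ℕ) ≠ e y := fun h => hxy (e.injective (Fin.ext h))
    have h2 : ({(e u : ℕ), (e v : ℕ)} : Finset ℕ) = {(e x : ℕ), (e y : ℕ)} := by
      apply Finset.geomSum_injective (n := 2) le_rfl
      simpa [Finset.sum_pair huv', Finset.sum_pair hxy'] using h
    have inj : ∀ a b : V, (e a : ℕ) = e b → a = b := fun a b h => e.injective (Fin.ext h)
    have hu : (e u : ℕ) ∈ ({(e x : ℕ), (e y : ℕ)} : Finset ℕ) := by rw [← h2]; simp
    have hv : (e v : ℕ) ∈ ({(e x : ℕ), (e y : ℕ)} : Finset ℕ) := by rw [← h2]; simp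
    simp only [Finset.mem_insert, Finset.mem_singleton] at hu hv
    rcases hu with hu | hu <;> rcases hv with hv | hv
    · exact absurd (hu.trans hv.symm) huv'
    · exact Or.inl ⟨inj _ _ hu, inj _ _ hv⟩
    · exact Or.inr ⟨inj _ _ hu, inj _ _ hv⟩
    · exact absurd (hu.trans hv.symm) huv'
  have hfin : {s : ℕ | ∃ p : V × V, G.Adj p.1 p.2 ∧ f p.1 + f p.2 = s}.Finite := by
    refine (Set.finite_range (fun p : V × V => f p.1 + f p.2)).subset ?_
    rintro s ⟨p, -, rfl⟩
    exact ⟨p, rfl⟩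
  let S : Finset ℕ := hfin.toFinset
  have hS : ∀ u v : V, u ≠ v → (G.Adj u v ↔ f u + f v ∈ S) := by
    intro u v huv
    simp only [S, Set.Finite.mem_toFinset, Set.mem_ofPred_eq]
    constructor
    · intro h
      exact ⟨(u, v), h, rfl⟩
    · rintro ⟨⟨x, y⟩, h, hs⟩
      rcases hf x y u v h.ne huv hs with ⟨rfl, rfl⟩ | ⟨rfl, rfl⟩
      · exact h
      · exact h.symm
  let T : Finset ℝ := S.image (fun s : ℕ => (s : ℝ)) ∪ S.image (fun s : ℕ => (s : ℝ) + 1 / 2)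
  have hcount : ∀ x : ℕ, Odd (T.filter (fun a => a ≤ (x : ℝ))).card ↔ x ∈ S := by
    intro x
    have h1 : T.filter (fun a => a ≤ (x : ℝ)) =
        (S.filter (fun s => s ≤ x)).image (fun s : ℕ => (s : ℝ)) ∪
        (S.filter (fun s => s < x)).image (fun s : ℕ => (s : ℝ) + 1 / 2) := by
      have key : ∀ s : ℕ, (s : ℝ) + 1 / 2 ≤ x ↔ s < x := by
        intro s
        constructor
        · intro h
          have : (s : ℝ) < x := by linarith
          exact_mod_cast this
        · intro h
          have : (s : ℝ) + 1 ≤ x := by exact_mod_cast h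
          linarith
      simp only [T, Finset.filter_union, Finset.filter_image, key, Nat.cast_le]
    have hdisj : Disjoint ((S.filter (fun s => s ≤ x)).image (fun s : ℕ => (s : ℝ)))
        ((S.filter (fun s => s < x)).image (fun s : ℕ => (s : ℝ) + 1 / 2)) := by
      rw [Finset.disjoint_left]
      intro a ha hb
      obtain ⟨p, -, rfl⟩ := Finset.mem_image.1 ha
      obtain ⟨q, -, hq⟩ := Finset.mem_image.1 hb
      have h3 : (2 * q + 1 : ℝ) = 2 * p := by linarith
      have h4 : 2 * q + 1 = 2 * p := by exact_mod_cast h3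
      omega
    have hle : (S.filter (fun s => s ≤ x)).card =
        (S.filter (fun s => s < x)).card + if x ∈ S then 1 else 0 := by
      have h5 : S.filter (fun s => s ≤ x) = S.filter (fun s => s < x) ∪ S.filter (fun s => s = x) := by
        ext s
        simp only [Finset.mem_filter, Finset.mem_union, le_iff_lt_or_eq]
        tauto
      rw [h5, Finset.card_union_of_disjoint, Finset.filter_eq']
      · split_ifs <;> simp
      · rw [Finset.disjoint_filter]
        intro s _ h h'
        omega
    have hinj : Function.Injective (fun s : ℕ => (s : ℝ) + 1 / 2) :=
      (add_left_injective (1 / 2 : ℝ)).comp Nat.cast_injective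
    rw [h1, Finset.card_union_of_disjoint hdisj,
      Finset.card_image_of_injective _ Nat.cast_injective,
      Finset.card_image_of_injective _ hinj, hle]
    by_cases hx : x ∈ S
    · simp only [hx, if_true, iff_true]
      exact ⟨_, by ring⟩
    · simp only [hx, if_false, iff_false, Nat.not_odd_iff_even]
      exact ⟨_, by ring⟩
  refine ⟨T.card, T.orderEmbOfFin rfl, fun v => (f v : ℝ), (T.orderEmbOfFin rfl).strictMono, ?_⟩
  intro u v huv
  rw [hS u v huv, ← hcount]
  have h6 : (Finset.univ.filter
      (fun i : Fin T.card => T.orderEmbOfFin rfl i ≤ (f u : ℝ) + (f v : ℝ))).card =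
      (T.filter (fun a => a ≤ ((f u + f v : ℕ) : ℝ))).card := by
    rw [← Finset.card_map (T.orderEmbOfFin rfl).toEmbedding]
    congr 1
    ext a
    simp only [Finset.mem_map, Finset.mem_filter, Finset.mem_univ, true_and, Nat.cast_add,
      RelEmbedding.coe_toEmbedding]
    constructor
    · rintro ⟨i, hi, rfl⟩
      exact ⟨T.orderEmbOfFin_mem rfl i, hi⟩
    · rintro ⟨ha, hle⟩
      have : a ∈ Set.range (T.orderEmbOfFin rfl) := by
        rw [Finset.range_orderEmbOfFin]; exact ha
      obtain ⟨i, rfl⟩ := this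
      exact ⟨i, hle, rfl⟩
  rw [h6]

/-- The clusters of `n₁K₁ ∪ n₂K₂ ∪ ⋯ ∪ nₜKₜ`: for every size `s ∈ [1, t]` there are `n s` of them. -/
abbrev Cluster (t : ℕ) (n : ℕ → ℕ) : Type :=
  Σ s : {s : ℕ // s ∈ Finset.Icc 1 t}, Fin (n s)

/-- The vertices of `n₁K₁ ∪ n₂K₂ ∪ ⋯ ∪ nₜKₜ`: a cluster of size `s` has `s` vertices. -/
abbrev ClusterVertex (t : ℕ) (n : ℕ → ℕ) : Type :=
  Σ c : Cluster t n, Fin (c.1 : ℕ)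

/-- The cluster graph `n₁K₁ ∪ n₂K₂ ∪ ⋯ ∪ nₜKₜ`: two vertices are adjacent if and only if they are
distinct and lie in the same cluster. -/
def clusterGraph (t : ℕ) (n : ℕ → ℕ) : SimpleGraph (ClusterVertex t n) where
  Adj x y := x ≠ y ∧ x.1 = y.1
  symm := ⟨fun _ _ h => ⟨h.1.symm, h.2.symm⟩⟩
  loopless := ⟨fun _ h => h.1 rfl⟩

/-- `q_m = m + C(m, 3) + 1`. -/
def qNum (m : ℕ) : ℕ := m + m.choose 3 + 1

/-! Let the level of a real `s` be the number of thresholds at most `s`. Distinct vertices are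
adjacent exactly when their rank sum has odd level, and at most `m` odd levels are `≤ 2 * m`.

Lower bound: keep three vertices of each cluster of size at least 3. If two different clusters have
edges on the same odd level, the end ranks are oppositely ordered, since otherwise a cross sum would
be squeezed onto that level. So a triangle with three distinct edge levels is determined by its set
of levels (at most `m.choose 3` of these), and a triangle with a repeated level is determined by the
level of one suitable edge (at most `m`). An odd top level `2 * m + 1` admits only one further
cluster. See `card_le_of_level_le` and `card_le_of_level_le_succ`.

Upper bound: by `exists_isolating_finset`, `m` prescribed edge sums cost `2 * m` thresholds. Generic
ranks with edge sums `2 e_l` are built in `exists_cluster_ranks`: the set of odd coordinates of a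
rank is a label of its cluster, and only equal labels can add up to an even vector. One-element
labels serve clusters of any size at least 3, three-element labels only triangles. One extra
threshold on top pays for one more cluster. -/

/-! ### Lower bounds -/

section LowerBound

variable {B : Type*} {N : ℝ → ℕ} {r : B → Fin 3 → ℝ}

/-- If sums of two different clusters have the same level, their ranks are oppositely ordered. -/
theorem lt_of_level_eq_of_le (hN : Monotone N)
    (hodd : ∀ x i j, i ≠ j → Odd (N (r x i + r x j)))
    (hcross : ∀ x y, x ≠ y → ∀ i j, ¬ Odd (N (r x i + r y j)))
    {x y : B} (hxy : x ≠ y) {i j i' j' : Fin 3} (hij : i ≠ j)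
    (h : N (r x i + r x j) = N (r y i' + r y j')) (h1 : r x i ≤ r y i') : r y j' < r x j := by
  -- Otherwise the cross sum of `r x i` and `r y j'` lies between the two edge sums, hence on their
  -- odd level.
  by_contra! h2
  apply hcross x y hxy i j'
  have e1 : N (r x i + r x j) ≤ N (r x i + r y j') := hN (by linarith)
  have e2 : N (r x i + r y j') ≤ N (r y i' + r y j') := hN (by linarith)
  rw [show N (r x i + r y j') = N (r x i + r x j) by omega]
  exact hodd x i j hij

/-- No rank of another cluster lies between the ranks `r x i` and `r x j`. -/
theorem lt_of_level_eq_of_le_foreign (hN : Monotone N)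
    (hodd : ∀ x i j, i ≠ j → Odd (N (r x i + r x j)))
    (hcross : ∀ x y, x ≠ y → ∀ i j, ¬ Odd (N (r x i + r y j)))
    {x y : B} (hxy : x ≠ y) {i j l : Fin 3} (hil : l ≠ i)
    (h : N (r x l + r x i) = N (r x l + r x j)) (p : Fin 3) (h1 : r x i ≤ r y p) :
    r x j < r y p := by
  by_contra! h2
  apply hcross x y hxy l p
  have e1 : N (r x l + r x i) ≤ N (r x l + r y p) := hN (by linarith)
  have e2 : N (r x l + r y p) ≤ N (r x l + r x j) := hN (by linarith)
  rw [show N (r x l + r y p) = N (r x l + r x i) by omega]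
  exact hodd x l i hil

theorem card_le_of_level_le [Fintype B] (hN : Monotone N) (hr : ∀ x, Monotone (r x))
    (hodd : ∀ x i j, i ≠ j → Odd (N (r x i + r x j)))
    (hcross : ∀ x y, x ≠ y → ∀ i j, ¬ Odd (N (r x i + r y j)))
    (m : ℕ) (hm : ∀ x, N (r x 1 + r x 2) ≤ 2 * m) :
    Fintype.card B ≤ m + m.choose 3 := by
  classical
  have h01 : ∀ x, r x 0 ≤ r x 1 := fun x => hr x (by decide)
  have h12 : ∀ x, r x 1 ≤ r x 2 := fun x => hr x (by decide)
  have hle1 : ∀ x, N (r x 0 + r x 1) ≤ N (r x 0 + r x 2) := fun x =>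
    hN (by linarith [h12 x])
  have hle2 : ∀ x, N (r x 0 + r x 2) ≤ N (r x 1 + r x 2) := fun x =>
    hN (by linarith [h01 x])
  have ho1 : ∀ x, Odd (N (r x 0 + r x 1)) := fun x => hodd x 0 1 (by decide)
  have ho2 : ∀ x, Odd (N (r x 0 + r x 2)) := fun x => hodd x 0 2 (by decide)
  have ho3 : ∀ x, Odd (N (r x 1 + r x 2)) := fun x => hodd x 1 2 (by decide)
  let O : Finset ℕ := (Finset.range m).image fun i => 2 * i + 1
  have hO : O.card = m := by
    rw [Finset.card_image_of_injective _ (fun a b h => by simpa using h), Finset.card_range]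
  have hmem : ∀ k, Odd k → k ≤ 2 * m → k ∈ O := by
    rintro k ⟨i, rfl⟩ hk
    exact Finset.mem_image.2 ⟨i, Finset.mem_range.2 (by omega), rfl⟩
  -- The ranks are sorted, so the three levels increase weakly and any repetition is between
  -- neighbours.
  let rep : Finset B := Finset.univ.filter fun x =>
    N (r x 0 + r x 1) = N (r x 0 + r x 2) ∨ N (r x 0 + r x 2) = N (r x 1 + r x 2)
  have hrep : rep.card ≤ m := by
    -- The two edges on the repeated level share a vertex; no foreign rank lies between their other
    -- two ends. The edge joining those ends has the level that identifies `x`.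
    have hpair : ∀ x ∈ rep, ∃ i j : Fin 3, i < j ∧ N (r x i + r x j) ∈ O ∧
        ∀ y, x ≠ y → ∀ p, r x i ≤ r y p → r x j < r y p := by
      intro x hx
      rcases (Finset.mem_filter.1 hx).2 with h | h
      · refine ⟨1, 2, by decide, hmem _ (ho3 x) (hm x), fun y hxy p =>
          lt_of_level_eq_of_le_foreign hN hodd hcross hxy (l := 0) (by decide) h p⟩
      · refine ⟨0, 1, by decide, hmem _ (ho1 x)
          (((hle1 x).trans (hle2 x)).trans (hm x)), fun y hxy p =>
          lt_of_level_eq_of_le_foreign hN hodd hcross hxy (l := 2) (by decide) ?_ p⟩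
        rw [add_comm (r x 2), add_comm (r x 2), h]
    choose! i j hij hmemO hgap using hpair
    rw [← hO]
    refine Finset.card_le_card_of_injOn (fun x => N (r x (i x) + r x (j x))) hmemO ?_
    intro x hx y hy hxy
    by_contra hne
    -- Opposite ordering gives `r y (j y) < r x (j x)`, while the gap of `x` puts `r y (i y)`, hence
    -- `r y (j y)`, above `r x (j x)`.
    have key : ∀ x ∈ rep, ∀ y ∈ rep, x ≠ y →
        N (r x (i x) + r x (j x)) = N (r y (i y) + r y (j y)) →
        r x (i x) ≤ r y (i y) → False := by
      intro x hx y hy hne he hle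
      have h1 := lt_of_level_eq_of_le hN hodd hcross hne (hij x hx).ne he hle
      have h2 := hgap x hx y hne _ hle
      linarith [hr y (hij y hy).le]
    rcases le_total (r x (i x)) (r y (i y)) with h | h
    · exact key x hx y hy hne hxy h
    · exact key y hy x hx (Ne.symm hne) hxy.symm h
  have hnrep : (Finset.univ.filter fun x => x ∉ rep).card ≤ m.choose 3 := by
    rw [← hO, ← Finset.card_powersetCard]
    have hlt : ∀ x, x ∉ rep → N (r x 0 + r x 1) < N (r x 0 + r x 2) ∧
        N (r x 0 + r x 2) < N (r x 1 + r x 2) := by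
      intro x hx
      simp only [rep, Finset.mem_filter, Finset.mem_univ, true_and, not_or] at hx
      exact ⟨lt_of_le_of_ne (hle1 x) hx.1, lt_of_le_of_ne (hle2 x) hx.2⟩
    refine Finset.card_le_card_of_injOn
      (fun x => {N (r x 0 + r x 1), N (r x 0 + r x 2), N (r x 1 + r x 2)}) ?_ ?_
    · intro x hx
      have hx' := hlt x (by simpa using hx)
      refine Finset.mem_coe.2 (Finset.mem_powersetCard.2 ⟨?_, ?_⟩)
      · intro k hk
        have h3 := hm x
        simp only [Finset.mem_insert, Finset.mem_singleton] at hk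
        rcases hk with rfl | rfl | rfl
        · exact hmem _ (ho1 x) (by omega)
        · exact hmem _ (ho2 x) (by omega)
        · exact hmem _ (ho3 x) h3
      · exact Finset.card_eq_three.2 ⟨_, _, _, by omega, by omega, by omega, rfl⟩
    · intro x hx y hy hxy
      have hx' := hlt x (by simpa using hx)
      have hy' := hlt y (by simpa using hy)
      by_contra hne
      have e : N (r x 0 + r x 1) = N (r y 0 + r y 1) ∧ N (r x 0 + r x 2) = N (r y 0 + r y 2) ∧
          N (r x 1 + r x 2) = N (r y 1 + r y 2) := by
        simp only [Finset.ext_iff, Finset.mem_insert, Finset.mem_singleton] at hxy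
        have a1 := (hxy (N (r x 0 + r x 1))).1 (by simp)
        have a2 := (hxy (N (r x 0 + r x 2))).1 (by simp)
        have a3 := (hxy (N (r x 1 + r x 2))).1 (by simp)
        omega
      -- Three pairwise opposite comparisons at the positions 0, 1, 2 are impossible.
      have key : ∀ x y : B, x ≠ y →
          N (r x 0 + r x 1) = N (r y 0 + r y 1) → N (r x 0 + r x 2) = N (r y 0 + r y 2) →
          N (r x 1 + r x 2) = N (r y 1 + r y 2) → r x 0 ≤ r y 0 → False := by
        intro x y hne e1 e2 e3 hle
        have b1 := lt_of_level_eq_of_le hN hodd hcross hne (by decide) e1 hle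
        have b2 := lt_of_level_eq_of_le hN hodd hcross hne (by decide) e2 hle
        have b3 := lt_of_level_eq_of_le hN hodd hcross hne.symm (by decide) e3.symm b1.le
        linarith
      rcases le_total (r x 0) (r y 0) with h | h
      · exact key x y hne e.1 e.2.1 e.2.2 h
      · exact key y x (Ne.symm hne) e.1.symm e.2.1.symm e.2.2.symm h
  have := Finset.card_filter_add_card_filter_not (s := (Finset.univ : Finset B)) (fun x => x ∈ rep)
  have h5 : (Finset.univ.filter fun x => x ∈ rep) = rep := by ext; simp
  rw [h5, Finset.card_univ] at this
  omega

/-- Only one cluster can reach the top level: if two did, the sum of their largest ranks would also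
be on that odd level. The other clusters fall under `card_le_of_level_le`. -/
theorem card_le_of_level_le_succ [Fintype B] (hN : Monotone N) (hr : ∀ x, Monotone (r x))
    (hodd : ∀ x i j, i ≠ j → Odd (N (r x i + r x j)))
    (hcross : ∀ x y, x ≠ y → ∀ i j, ¬ Odd (N (r x i + r y j)))
    (m : ℕ) (hm : ∀ s, N s ≤ 2 * m + 1) :
    Fintype.card B ≤ m + m.choose 3 + 1 := by
  classical
  have htop : ∀ x y, N (r x 1 + r x 2) = 2 * m + 1 → N (r y 1 + r y 2) = 2 * m + 1 →
      r x 2 ≤ r y 2 → x = y := by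
    intro x y hx _ hle
    by_contra hne
    apply hcross x y hne 2 2
    have h12 : r x 1 ≤ r x 2 := hr x (by decide)
    have h1 : N (r x 1 + r x 2) ≤ N (r x 2 + r y 2) := hN (by linarith)
    rw [show N (r x 2 + r y 2) = 2 * m + 1 from le_antisymm (hm _) (by omega)]
    exact ⟨m, rfl⟩
  have h1 : (Finset.univ.filter fun x => N (r x 1 + r x 2) = 2 * m + 1).card ≤ 1 := by
    rw [Finset.card_le_one]
    intro x hx y hy
    simp only [Finset.mem_filter, Finset.mem_univ, true_and] at hx hy
    rcases le_total (r x 2) (r y 2) with h | h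
    · exact htop x y hx hy h
    · exact (htop y x hy hx h).symm
  have h2 := card_le_of_level_le (B := {x // ¬ N (r x 1 + r x 2) = 2 * m + 1})
    (r := fun x => r x.1) hN (fun x => hr x) (fun x => hodd x)
    (fun x y hxy => hcross x y (fun h => hxy (Subtype.ext h))) m
    (fun x => by have := hm (r x.1 1 + r x.1 2); have := x.2; omega)
  rw [Fintype.card_subtype] at h2
  have h3 := Finset.card_filter_add_card_filter_not (s := (Finset.univ : Finset B))
    (fun x => N (r x 1 + r x 2) = 2 * m + 1)
  rw [Finset.card_univ] at h3
  omega

end LowerBound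

/-! ### Lower bounds for cluster graphs -/

/-- The number of thresholds that are at most `s`. -/
noncomputable def thresholdLevel {k : ℕ} (θ : Fin k → ℝ) (s : ℝ) : ℕ :=
  (Finset.univ.filter fun i : Fin k => θ i ≤ s).card

theorem thresholdLevel_mono {k : ℕ} (θ : Fin k → ℝ) : Monotone (thresholdLevel θ) := by
  intro s t hst
  refine Finset.card_le_card fun i hi => ?_
  simp only [Finset.mem_filter, Finset.mem_univ, true_and] at hi ⊢
  exact hi.trans hst

theorem thresholdLevel_le {k : ℕ} (θ : Fin k → ℝ) (s : ℝ) : thresholdLevel θ s ≤ k :=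
  (Finset.card_le_univ _).trans (Fintype.card_fin k).le

variable {t : ℕ} {n : ℕ → ℕ}

/-- The number of clusters with at least `a` vertices. -/
theorem card_cluster_filter {a : ℕ} (ha : 1 ≤ a) :
    Fintype.card {c : Cluster t n // a ≤ (c.1 : ℕ)} = ∑ j ∈ Finset.Icc a t, n j := by
  have h : ∑ c : Cluster t n, (if a ≤ (c.1 : ℕ) then 1 else 0) =
      ∑ s : {s : ℕ // s ∈ Finset.Icc 1 t}, if a ≤ (s : ℕ) then n s else 0 := by
    rw [Fintype.sum_sigma]
    refine Finset.sum_congr rfl fun s _ => ?_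
    change ∑ _i : Fin (n s), (if a ≤ (s : ℕ) then 1 else 0) = _
    simp
  rw [Fintype.card_subtype, Finset.card_filter, h,
    Finset.sum_coe_sort (Finset.Icc 1 t) (fun s => if a ≤ s then n s else 0),
    ← Finset.sum_filter]
  congr 1
  ext s
  simp only [Finset.mem_filter, Finset.mem_Icc]
  omega

theorem exists_sorted_triangles {k : ℕ} (h : IsKThresholdGraph (clusterGraph t n) k) :
    ∃ (N : ℝ → ℕ) (r : {c : Cluster t n // 3 ≤ (c.1 : ℕ)} → Fin 3 → ℝ), Monotone N ∧
      (∀ s, N s ≤ k) ∧ (∀ x, Monotone (r x)) ∧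
      (∀ x i j, i ≠ j → Odd (N (r x i + r x j))) ∧
      (∀ x y, x ≠ y → ∀ i j, ¬ Odd (N (r x i + r y j))) := by
  obtain ⟨θ, r, -, h⟩ := h
  let f (x : {c : Cluster t n // 3 ≤ (c.1 : ℕ)}) (i : Fin 3) : ClusterVertex t n :=
    ⟨x.1, Fin.castLE x.2 i⟩
  let σ (x : {c : Cluster t n // 3 ≤ (c.1 : ℕ)}) := Tuple.sort fun i => r (f x i)
  refine ⟨thresholdLevel θ, fun x i => r (f x (σ x i)), thresholdLevel_mono θ,
    thresholdLevel_le θ, fun x => Tuple.monotone_sort fun i => r (f x i), ?_, ?_⟩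
  · intro x i j hij
    have hne : f x (σ x i) ≠ f x (σ x j) := by simpa [f] using hij
    exact (h _ _ hne).1 ⟨hne, rfl⟩
  · intro x y hxy i j hodd
    have hne : (f x (σ x i)).1 ≠ (f y (σ y j)).1 := fun h => hxy (Subtype.ext h)
    exact hne ((h _ _ fun e => hne (congrArg _ e)).2 hodd).2

theorem sum_le_of_isKThresholdGraph {k m : ℕ} (h : IsKThresholdGraph (clusterGraph t n) k)
    (hk : k ≤ 2 * m) : ∑ j ∈ Finset.Icc 3 t, n j ≤ m + m.choose 3 := by
  obtain ⟨N, r, hN, hNk, hr, hodd, hcross⟩ := exists_sorted_triangles h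
  rw [← card_cluster_filter (by norm_num)]
  exact card_le_of_level_le hN hr hodd hcross m fun x => (hNk _).trans hk

theorem sum_le_succ_of_isKThresholdGraph {k m : ℕ} (h : IsKThresholdGraph (clusterGraph t n) k)
    (hk : k ≤ 2 * m + 1) : ∑ j ∈ Finset.Icc 3 t, n j ≤ m + m.choose 3 + 1 := by
  obtain ⟨N, r, hN, hNk, hr, hodd, hcross⟩ := exists_sorted_triangles h
  rw [← card_cluster_filter (by norm_num)]
  exact card_le_of_level_le_succ hN hr hodd hcross m fun x => (hNk _).trans hk

/-- A `k`-threshold cluster graph with `k ≤ 1` has at most `k` clusters with an edge. -/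
theorem sum_le_one_of_isKThresholdGraph {k : ℕ} (h : IsKThresholdGraph (clusterGraph t n) k)
    (hk : k ≤ 1) : ∑ j ∈ Finset.Icc 2 t, n j ≤ k := by
  obtain ⟨θ, r, -, h⟩ := h
  rw [← card_cluster_filter (by norm_num)]
  -- Level 1 is the only odd level and the highest possible one, so doubling the larger rank of an
  -- edge stays on it.
  have hlev : ∀ x : {c : Cluster t n // 2 ≤ (c.1 : ℕ)}, ∃ p : ClusterVertex t n, p.1 = x.1 ∧
      Odd (thresholdLevel θ (r p + r p)) := by
    intro x
    have hne : (⟨x.1, Fin.castLE x.2 0⟩ : ClusterVertex t n) ≠ ⟨x.1, Fin.castLE x.2 1⟩ := by simp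
    have hodd := (h _ _ hne).1 ⟨hne, rfl⟩
    change Odd (thresholdLevel θ _) at hodd
    have hone : ∀ s, thresholdLevel θ (r ⟨x.1, Fin.castLE x.2 0⟩ + r ⟨x.1, Fin.castLE x.2 1⟩) ≤
        thresholdLevel θ s → Odd (thresholdLevel θ s) := by
      intro s hs
      have h1 := (thresholdLevel_le θ s).trans hk
      have h2 := hodd.pos
      rw [show thresholdLevel θ s = 1 by omega]
      exact odd_one
    rcases le_total (r ⟨x.1, Fin.castLE x.2 0⟩) (r ⟨x.1, Fin.castLE x.2 1⟩) with hle | hle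
    · exact ⟨_, rfl, hone _ (thresholdLevel_mono θ (by linarith))⟩
    · exact ⟨_, rfl, hone _ (thresholdLevel_mono θ (by linarith))⟩
  choose p hp hpo using hlev
  interval_cases k
  · rw [Nat.le_zero, Fintype.card_eq_zero_iff]
    refine ⟨fun x => ?_⟩
    have h1 := (hpo x).pos
    have h2 := thresholdLevel_le θ (r (p x) + r (p x))
    omega
  · rw [Fintype.card_le_one_iff]
    have key : ∀ x y, r (p x) ≤ r (p y) → x = y := by
      intro x y hle
      by_contra hne
      have hne' : (p x).1 ≠ (p y).1 := by
        rw [hp, hp]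
        exact fun h => hne (Subtype.ext h)
      have h1 := (hpo x).pos
      have h2 : thresholdLevel θ (r (p x) + r (p x)) ≤ thresholdLevel θ (r (p x) + r (p y)) :=
        thresholdLevel_mono θ (by linarith)
      have h3 := thresholdLevel_le θ (r (p x) + r (p y))
      refine hne' ((h _ _ fun e => hne' (congrArg _ e)).2 ?_).2
      change Odd (thresholdLevel θ _)
      rw [show thresholdLevel θ (r (p x) + r (p y)) = 1 by omega]
      exact odd_one
    intro x y
    rcases le_total (r (p x)) (r (p y)) with hle | hle
    · exact key x y hle
    · exact (key y x hle).symm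

/-! ### Constructions -/

/-! ### Thresholds from prescribed edge sums -/

section Thresholds

variable {V : Type*} {G : SimpleGraph V}

theorem isKThresholdGraph_of_finset (T : Finset ℝ) (r : V → ℝ)
    (h : ∀ u v, u ≠ v → (G.Adj u v ↔ Odd (T.filter (· ≤ r u + r v)).card)) :
    IsKThresholdGraph G T.card := by
  refine ⟨T.orderEmbOfFin rfl, r, (T.orderEmbOfFin rfl).strictMono, fun u v huv => ?_⟩
  rw [h u v huv]
  have h6 : (Finset.univ.filter
      (fun i : Fin T.card => T.orderEmbOfFin rfl i ≤ r u + r v)).card =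
      (T.filter (· ≤ r u + r v)).card := by
    rw [← Finset.card_map (T.orderEmbOfFin rfl).toEmbedding]
    congr 1
    ext a
    simp only [Finset.mem_map, Finset.mem_filter, Finset.mem_univ, true_and,
      RelEmbedding.coe_toEmbedding]
    constructor
    · rintro ⟨i, hi, rfl⟩
      exact ⟨T.orderEmbOfFin_mem rfl i, hi⟩
    · rintro ⟨ha, hle⟩
      have : a ∈ Set.range (T.orderEmbOfFin rfl) := by
        rw [Finset.range_orderEmbOfFin]; exact ha
      obtain ⟨i, rfl⟩ := this
      exact ⟨i, hle, rfl⟩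
  rw [h6]

theorem exists_pos_forall_add_lt (S D : Finset ℝ) :
    ∃ ε : ℝ, 0 < ε ∧ ∀ s ∈ S, ∀ d ∈ D, s < d → s + ε < d := by
  have h : ∀ᶠ ε in nhdsWithin (0 : ℝ) (Set.Ioi 0), 0 < ε ∧ ∀ s ∈ S, ∀ d ∈ D, s < d → s + ε < d := by
    refine (eventually_mem_nhdsWithin).and ?_
    rw [Filter.eventually_all_finset]
    intro s _
    rw [Filter.eventually_all_finset]
    intro d _
    by_cases hsd : s < d
    · filter_upwards [Ioo_mem_nhdsGT (sub_pos.2 hsd)] with ε hε _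
      linarith [hε.2]
    · exact Filter.Eventually.of_forall fun _ h => absurd h hsd
  exact h.exists

/-- A finite set of thresholds which isolates the points of `S` among those of `D`. -/
theorem exists_isolating_finset (S D : Finset ℝ) (hSD : S ⊆ D) :
    ∃ T : Finset ℝ, T.card = 2 * S.card ∧
      (∀ d ∈ D, Odd (T.filter (· ≤ d)).card ↔ d ∈ S) ∧
      (∀ d ∈ D, (∀ s ∈ S, s < d) → ∀ x ∈ T, x < d) := by
  obtain ⟨ε, hε, h⟩ := exists_pos_forall_add_lt S D
  have hdisj : Disjoint S (S.map (addRightEmbedding ε)) := by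
    rw [Finset.disjoint_left]
    intro a ha hb
    obtain ⟨s, hs, rfl⟩ := Finset.mem_map.1 hb
    exact lt_irrefl _ (h s hs _ (hSD ha) (lt_add_of_pos_right s hε))
  -- Each `s < d` contributes both `s` and `s + ε` to the count at `d`, and `s = d` contributes only
  -- `s`. The last clause leaves room for one more threshold on top.
  refine ⟨S ∪ S.map (addRightEmbedding ε), ?_, ?_, ?_⟩
  · rw [Finset.card_union_of_disjoint hdisj, Finset.card_map]
    omega
  · intro d hd
    have h1 : (S.map (addRightEmbedding ε)).filter (· ≤ d) =
        (S.filter (· < d)).map (addRightEmbedding ε) := by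
      rw [Finset.filter_map]
      congr 1
      refine Finset.filter_congr fun s hs => ?_
      change s + ε ≤ d ↔ s < d
      exact ⟨fun h => by linarith, fun hlt => (h s hs d hd hlt).le⟩
    have h2 : (S.filter (· ≤ d)).card = (S.filter (· < d)).card + if d ∈ S then 1 else 0 := by
      have h5 : S.filter (· ≤ d) = S.filter (· < d) ∪ S.filter (· = d) := by
        ext s
        simp only [Finset.mem_filter, Finset.mem_union, le_iff_lt_or_eq]
        tauto
      rw [h5, Finset.card_union_of_disjoint, Finset.filter_eq']
      · split_ifs <;> simp
      · rw [Finset.disjoint_filter]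
        exact fun s _ => ne_of_lt
    rw [Finset.filter_union, h1, Finset.card_union_of_disjoint, Finset.card_map, h2]
    · split_ifs with hS
      · simp only [hS, iff_true]
        exact ⟨_, by ring⟩
      · simp only [hS, iff_false, Nat.not_odd_iff_even]
        exact ⟨_, by ring⟩
    · exact hdisj.mono (Finset.filter_subset _ _) (Finset.map_subset_map.2 (Finset.filter_subset _ _))
  · intro d hd hlt x hx
    rcases Finset.mem_union.1 hx with hx | hx
    · exact hlt x hx
    · obtain ⟨s, hs, rfl⟩ := Finset.mem_map.1 hx
      exact h s hs d hd (hlt s hs)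

theorem isKThresholdGraph_two_mul [Finite V] (S : Finset ℝ) (r : V → ℝ)
    (h : ∀ u v, u ≠ v → (G.Adj u v ↔ r u + r v ∈ S)) : IsKThresholdGraph G (2 * S.card) := by
  classical
  have hfin := Set.finite_range fun p : V × V => r p.1 + r p.2
  obtain ⟨T, hT, hodd, -⟩ := exists_isolating_finset S (S ∪ hfin.toFinset)
    Finset.subset_union_left
  rw [← hT]
  refine isKThresholdGraph_of_finset T r fun u v huv => ?_
  rw [h u v huv, hodd]
  exact Finset.mem_union_right _ (hfin.mem_toFinset.2 ⟨(u, v), rfl⟩)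

theorem isKThresholdGraph_two_mul_add_one [Finite V] (S : Finset ℝ) (τ : ℝ) (hτ : ∀ s ∈ S, s < τ)
    (r : V → ℝ) (h : ∀ u v, u ≠ v → (G.Adj u v ↔ r u + r v ∈ S ∨ τ ≤ r u + r v)) :
    IsKThresholdGraph G (2 * S.card + 1) := by
  classical
  have hfin := Set.finite_range fun p : V × V => r p.1 + r p.2
  obtain ⟨T, hT, hodd, hlt⟩ := exists_isolating_finset S (S ∪ hfin.toFinset ∪ {τ})
    (Finset.subset_union_left.trans Finset.subset_union_left)
  have hTτ := hlt τ (Finset.mem_union_right _ (Finset.mem_singleton_self τ)) hτ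
  have hτT : τ ∉ T := fun h => lt_irrefl _ (hTτ τ h)
  rw [← hT, ← Finset.card_insert_of_notMem hτT]
  refine isKThresholdGraph_of_finset _ r fun u v huv => ?_
  have ho := hodd (r u + r v) (Finset.mem_union_left _
    (Finset.mem_union_right _ (hfin.mem_toFinset.2 ⟨(u, v), rfl⟩)))
  rw [h u v huv, Finset.filter_insert]
  split_ifs with hle
  · have hall : T.filter (· ≤ r u + r v) = T :=
      Finset.filter_true_of_mem fun x hx => (hTτ x hx).le.trans hle
    rw [hall, Finset.card_insert_of_notMem hτT, hT]
    exact iff_of_true (Or.inr hle) ⟨_, rfl⟩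
  · rw [ho]
    tauto

end Thresholds

/-! ### Generic ranks with few edge sums -/

section Ranks

/-- `ℝ` has infinite dimension over `ℚ`, so finitely many basis vectors span a free `ℤ`-module. Rank
sums can thus be compared as integer vectors. -/
theorem exists_injective_addMonoidHom (ι : Type*) [Finite ι] :
    ∃ φ : (ι → ℤ) →+ ℝ, Function.Injective φ := by
  have := Fintype.ofFinite ι
  have hinf : Infinite (Module.Free.ChooseBasisIndex ℚ ℝ) := by
    by_contra hfin
    rw [not_infinite_iff_finite] at hfin
    have h1 := (Module.Free.chooseBasis ℚ ℝ).mk_eq_rank''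
    rw [Real.rank_rat_real] at h1
    exact absurd (Cardinal.lt_aleph0_of_finite _)
      (not_lt.2 (h1 ▸ Cardinal.aleph0_le_continuum))
  obtain ⟨e⟩ : Nonempty (ι ↪ Module.Free.ChooseBasisIndex ℚ ℝ) :=
    ⟨(Fintype.equivFin ι).toEmbedding.trans (Fin.valEmbedding.trans (Infinite.natEmbedding _))⟩
  have hli : LinearIndependent ℤ (Module.Free.chooseBasis ℚ ℝ ∘ e) :=
    ((Module.Free.chooseBasis ℚ ℝ).linearIndependent.comp e e.injective).restrict_scalars
      (by intro a b hab; simpa using hab)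
  rw [linearIndependent_iff_injective_fintypeLinearCombination] at hli
  exact ⟨(Fintype.linearCombination ℤ (Module.Free.chooseBasis ℚ ℝ ∘ e)).toAddMonoidHom, hli⟩

variable {ι : Type*} [DecidableEq ι]

theorem exists_triangle_ranks {T : Finset ι} (hT : T.card = 3) :
    ∃ ρ : Fin 3 → ι → ℤ, (∀ i j, i ≠ j → ∃ l ∈ T, ρ i + ρ j = Pi.single l 2) ∧
      ∀ i x, Odd (ρ i x) ↔ x ∈ T := by
  obtain ⟨a, b, c, hab, hac, hbc, rfl⟩ := Finset.card_eq_three.1 hT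
  let e (l : ι) : ι → ℤ := Pi.single l 1
  have he : ∀ l, Pi.single l 2 = e l + e l := fun l => by
    rw [← Pi.single_add]
    norm_num
  -- Adding two of these vectors cancels all but twice one basis vector; modulo 2 each is `e a + e b
  -- + e c`.
  refine ⟨![e b + e c - e a, e a + e c - e b, e a + e b - e c], ?_, ?_⟩
  · simp only [he]
    intro i j hij
    fin_cases i <;> fin_cases j <;> simp at hij ⊢
    · exact Or.inr (Or.inr (by abel))
    · exact Or.inr (Or.inl (by abel))
    · exact Or.inr (Or.inr (by abel))
    · exact Or.inl (by abel)
    · exact Or.inr (Or.inl (by abel))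
    · exact Or.inl (by abel)
  · intro i x
    fin_cases i <;> simp only [e, Finset.mem_insert, Finset.mem_singleton] <;>
      by_cases h1 : x = a <;> by_cases h2 : x = b <;> by_cases h3 : x = c <;>
      simp_all

/-- Used to give the one-element labels to clusters of size at least 4 before the remaining labels
are distributed. -/
theorem exists_injective_of_card_le {α β : Type*} [Fintype α] [DecidableEq β] (p : α → Prop)
    [DecidablePred p] {A C : Finset β} (hAC : A ⊆ C) (hp : Fintype.card {x // p x} ≤ A.card)
    (hα : Fintype.card α ≤ C.card) :
    ∃ g : α → β, Function.Injective g ∧ (∀ x, g x ∈ C) ∧ ∀ x, p x → g x ∈ A := by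
  obtain ⟨f⟩ : Nonempty ({x // p x} ↪ A) :=
    Function.Embedding.nonempty_of_card_le (by simpa using hp)
  rcases isEmpty_or_nonempty β with hβ | ⟨⟨b⟩⟩
  · have h0 : Fintype.card α = 0 := by
      rw [Finset.eq_empty_of_isEmpty C] at hα
      simpa using hα
    have := Fintype.card_eq_zero_iff.1 h0
    exact ⟨isEmptyElim, fun x => isEmptyElim x, isEmptyElim, isEmptyElim⟩
  let f' (x : α) : β := if h : p x then f ⟨x, h⟩ else b
  have hf' : ∀ x (h : p x), f' x = f ⟨x, h⟩ := fun x h => dif_pos h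
  have hinj : Set.InjOn f' {x | p x} := by
    intro x hx y hy hxy
    rw [hf' x hx, hf' y hy] at hxy
    simpa using f.injective (Subtype.ext hxy)
  let I := (Finset.univ.filter p).image f'
  have hIA : ∀ y ∈ I, y ∈ A := by
    intro y hy
    obtain ⟨x, hx, rfl⟩ := Finset.mem_image.1 hy
    rw [hf' x (Finset.mem_filter.1 hx).2]
    exact (f _).2
  obtain ⟨D, hID, hDC, hD⟩ := Finset.exists_subsuperset_card_eq
    (show I ⊆ C from fun y hy => hAC (hIA y hy))
    (Finset.card_image_le.trans (Finset.card_le_univ _)) hα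
  obtain ⟨g, hg⟩ := Set.MapsTo.exists_equiv_extend_of_card_eq hD.symm
    (s := {x | p x}) (f := f')
    (fun x hx => hID (Finset.mem_image_of_mem _ (by simpa using hx))) hinj
  refine ⟨fun x => g x, fun x y h => g.injective (Subtype.ext h), fun x => hDC (g x).2, ?_⟩
  intro x hx
  change (g x : β) ∈ A
  rw [hg x hx, hf' x hx]
  exact (f _).2

/-- Ranks for the clusters in `P` whose edge sums are exactly the elements of a set of size `m`:
the parities of the coordinates of a generic rank determine the cluster. -/
theorem exists_cluster_ranks {m : ℕ} (hm : 0 < m) (P : Cluster t n → Prop) [DecidablePred P]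
    (h3 : Fintype.card {c // P c ∧ 3 ≤ (c.1 : ℕ)} ≤ m + m.choose 3)
    (h4 : Fintype.card {c // P c ∧ 4 ≤ (c.1 : ℕ)} ≤ m) :
    ∃ (S : Finset ℝ) (r : ClusterVertex t n → ℝ), S.card = m ∧
      ∀ u v, u ≠ v → P u.1 → P v.1 → (u.1 = v.1 ↔ r u + r v ∈ S) := by
  -- The left coordinates index the edge sums; the right ones are private to single clusters and
  -- label those of size at most 2.
  let ι := Fin m ⊕ Cluster t n
  obtain ⟨φ, hφ⟩ := exists_injective_addMonoidHom ι
  let sums : Finset (ι → ℤ) := Finset.univ.image fun l : Fin m => Pi.single (Sum.inl l) 2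
  have hsums : sums.card = m := by
    rw [Finset.card_image_of_injective, Finset.card_univ, Fintype.card_fin]
    intro l l' h
    have := congrFun h (Sum.inl l)
    simp only [Pi.single_eq_same, Pi.single_apply] at this
    split_ifs at this with h'
    · exact Sum.inl_injective h'
    · norm_num at this
  have hmem : ∀ l : Fin m, (Pi.single (Sum.inl l) 2 : ι → ℤ) ∈ sums :=
    fun l => Finset.mem_image_of_mem _ (Finset.mem_univ l)
  have hdis : Disjoint (Finset.univ.powersetCard 1 : Finset (Finset (Fin m)))
      (Finset.univ.powersetCard 3) := Finset.pairwise_disjoint_powersetCard _ (by norm_num)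
  obtain ⟨g, hg, hg13, hg1⟩ := exists_injective_of_card_le
    (α := {c : Cluster t n // P c ∧ 3 ≤ (c.1 : ℕ)}) (fun c => 4 ≤ (c.1.1 : ℕ))
    (A := (Finset.univ.powersetCard 1 : Finset (Finset (Fin m))))
    (C := Finset.univ.powersetCard 1 ∪ Finset.univ.powersetCard 3)
    Finset.subset_union_left
    (by
      rw [Finset.card_powersetCard, Finset.card_univ, Fintype.card_fin, Nat.choose_one_right]
      refine le_trans (Fintype.card_le_of_injective
        (fun c => (⟨c.1.1, c.1.2.1, c.2⟩ : {c : Cluster t n // P c ∧ 4 ≤ (c.1 : ℕ)})) ?_) h4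
      intro c d h
      exact Subtype.ext (Subtype.ext (Subtype.mk.inj h)))
    (by
      rw [Finset.card_union_of_disjoint hdis, Finset.card_powersetCard, Finset.card_powersetCard,
        Finset.card_univ, Fintype.card_fin, Nat.choose_one_right]
      exact h3)
  let T (c : Cluster t n) : Finset ι :=
    if h : P c ∧ 3 ≤ (c.1 : ℕ) then (g ⟨c, h⟩).map Function.Embedding.inl else {Sum.inr c}
  have hT : ∀ c d, P c → P d → T c = T d → c = d := by
    intro c d hc hd h
    simp only [T] at h
    split_ifs at h with h1 h2 h2
    · simpa using hg (Finset.map_injective _ h)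
    · have := Finset.ext_iff.1 h (Sum.inr d)
      simp [Function.Embedding.inl] at this
    · have := Finset.ext_iff.1 h (Sum.inr c)
      simp [Function.Embedding.inl] at this
    · simpa using h
  have hρ : ∀ c : Cluster t n, ∃ ρ : Fin (c.1 : ℕ) → ι → ℤ, P c →
      (∀ i j, i ≠ j → ρ i + ρ j ∈ sums) ∧ ∀ i x, Odd (ρ i x) ↔ x ∈ T c := by
    intro c
    by_cases hc : P c
    swap
    · exact ⟨0, fun h => absurd h hc⟩
    by_cases h3 : 3 ≤ (c.1 : ℕ)
    · have hTc : T c = (g ⟨c, hc, h3⟩).map Function.Embedding.inl := dif_pos ⟨hc, h3⟩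
      rcases Finset.mem_union.1 (hg13 ⟨c, hc, h3⟩) with h | h
      · obtain ⟨a, ha⟩ := Finset.card_eq_one.1 (Finset.mem_powersetCard.1 h).2
        -- A one-element label: all vertices share the rank `e_a`, which works for any cluster size.
        refine ⟨fun _ => Pi.single (Sum.inl a) 1, fun _ => ⟨fun i j _ => ?_, fun i x => ?_⟩⟩
        · rw [← Pi.single_add]
          exact hmem a
        · rw [hTc, ha]
          by_cases hx : x = Sum.inl a <;> simp [hx]
      · have hlt : ¬ 4 ≤ (c.1 : ℕ) := fun h4 =>
          Finset.disjoint_left.1 hdis (hg1 ⟨c, hc, h3⟩ h4) h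
        have hc3 : (c.1 : ℕ) = 3 := by omega
        have hcard : (T c).card = 3 := by
          rw [hTc, Finset.card_map, (Finset.mem_powersetCard.1 h).2]
        obtain ⟨ρ, h1, h2⟩ := exists_triangle_ranks hcard
        refine ⟨fun i => ρ (Fin.cast hc3 i), fun _ => ⟨fun i j hij => ?_, fun i x => h2 _ x⟩⟩
        obtain ⟨l, hl, h⟩ := h1 (Fin.cast hc3 i) (Fin.cast hc3 j) (by simpa using hij)
        rw [h]
        rw [hTc] at hl
        obtain ⟨l, -, rfl⟩ := Finset.mem_map.1 hl
        exact hmem l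
    · have hTc : T c = {Sum.inr c} := dif_neg fun h => h3 h.2
      -- At most two vertices, whose private coordinates cancel; any left index would do, and `0`
      -- exists because `0 < m`.
      refine ⟨fun i => if (i : ℕ) = 0 then Pi.single (Sum.inr c) 1 else
        Pi.single (Sum.inl ⟨0, hm⟩) 2 - Pi.single (Sum.inr c) 1, fun _ =>
        ⟨fun i j hij => ?_, fun i x => ?_⟩⟩
      · have hij' : (i : ℕ) ≠ j := fun h => hij (Fin.ext h)
        have hi := i.2
        have hj := j.2
        beta_reduce
        by_cases h0 : (i : ℕ) = 0
        · rw [if_pos h0, if_neg (by omega), add_sub_cancel]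
          exact hmem _
        · rw [if_neg h0, if_pos (by omega), sub_add_cancel]
          exact hmem _
      · rw [hTc, Finset.mem_singleton]
        beta_reduce
        rcases x with x | x
        · split_ifs
          · simp
          · by_cases hx : x = ⟨0, hm⟩ <;> simp [hx]
        · split_ifs <;> by_cases hx : (Sum.inr x : ι) = Sum.inr c <;> simp [hx]
  choose ρ hρ using hρ
  refine ⟨sums.map ⟨φ, hφ⟩, fun u => φ (ρ u.1 u.2), by rw [Finset.card_map, hsums], ?_⟩
  rintro ⟨c, i⟩ ⟨d, j⟩ huv hc hd
  have hφmem : φ (ρ c i) + φ (ρ d j) ∈ sums.map ⟨φ, hφ⟩ ↔ ρ c i + ρ d j ∈ sums := by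
    rw [← map_add]
    exact Finset.mem_map' ⟨φ, hφ⟩
  change c = d ↔ φ (ρ c i) + φ (ρ d j) ∈ _
  rw [hφmem]
  constructor
  · rintro rfl
    exact (hρ c hc).1 i j fun h => huv (by rw [h])
  · intro h
    obtain ⟨l, -, hl⟩ := Finset.mem_image.1 h
    refine hT c d hc hd (Finset.ext fun x => ?_)
    rw [← (hρ c hc).2 i x, ← (hρ d hd).2 j x]
    -- The sum is `2 e_l`, so the two ranks agree modulo 2 in every coordinate and their labels
    -- coincide.
    have hx : Even (ρ c i x + ρ d j x) := by
      rw [← Pi.add_apply, ← hl, Pi.single_apply]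
      split_ifs <;> simp
    rw [Int.even_add] at hx
    rw [← Int.not_even_iff_odd, ← Int.not_even_iff_odd, hx]

end Ranks

/-! ### Representations of cluster graphs -/

section ClusterGraph

theorem clusterGraph_adj_iff {u v : ClusterVertex t n} (h : u ≠ v) :
    (clusterGraph t n).Adj u v ↔ u.1 = v.1 :=
  ⟨fun h => h.2, fun h' => ⟨h, h'⟩⟩

theorem two_le_of_ne {u v : ClusterVertex t n} (h : u ≠ v) (huv : u.1 = v.1) :
    2 ≤ (u.1.1 : ℕ) := by
  obtain ⟨c, i⟩ := u
  obtain ⟨d, j⟩ := v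
  obtain rfl : c = d := huv
  have hij : (i : ℕ) ≠ j := fun e => h (by rw [Fin.ext e])
  have hi := i.2
  have hj := j.2
  change 2 ≤ (c.1 : ℕ)
  omega

theorem isKThresholdGraph_zero (h2 : ∑ j ∈ Finset.Icc 2 t, n j = 0) :
    IsKThresholdGraph (clusterGraph t n) 0 := by
  rw [← card_cluster_filter (by norm_num), Fintype.card_eq_zero_iff] at h2
  refine isKThresholdGraph_two_mul ∅ 0 fun u v huv => ?_
  rw [clusterGraph_adj_iff huv]
  exact iff_of_false (fun h => h2.false ⟨u.1, two_le_of_ne huv h⟩) (Finset.notMem_empty _)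

theorem isKThresholdGraph_one (h2 : ∑ j ∈ Finset.Icc 2 t, n j ≤ 1) :
    IsKThresholdGraph (clusterGraph t n) 1 := by
  rw [← card_cluster_filter (by norm_num), Fintype.card_le_one_iff] at h2
  refine isKThresholdGraph_two_mul_add_one ∅ 2 (by simp)
    (fun u => if 2 ≤ (u.1.1 : ℕ) then 1 else 0) fun u v huv => ?_
  rw [clusterGraph_adj_iff huv]
  constructor
  · intro h
    right
    rw [if_pos (two_le_of_ne huv h), if_pos (two_le_of_ne huv.symm h.symm)]
    norm_num
  · rintro (h | h)
    · exact absurd h (Finset.notMem_empty _)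
    · by_contra hne
      split_ifs at h with hu hv hv
      · exact hne (congrArg Subtype.val (h2 ⟨u.1, hu⟩ ⟨v.1, hv⟩))
      all_goals norm_num at h

theorem isKThresholdGraph_clusterGraph_even {m : ℕ} (hm : 0 < m)
    (h3 : ∑ j ∈ Finset.Icc 3 t, n j ≤ m + m.choose 3) (h4 : ∑ j ∈ Finset.Icc 4 t, n j ≤ m) :
    IsKThresholdGraph (clusterGraph t n) (2 * m) := by
  rw [← card_cluster_filter (by norm_num)] at h3 h4
  obtain ⟨S, r, rfl, h⟩ := exists_cluster_ranks hm (fun _ : Cluster t n => True)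
    (by simpa only [true_and] using h3) (by simpa only [true_and] using h4)
  exact isKThresholdGraph_two_mul S r fun u v huv =>
    (clusterGraph_adj_iff huv).trans (h u v huv trivial trivial)

theorem card_ne_and_lt (c₀ : Cluster t n) {a : ℕ} (ha : a ≤ (c₀.1 : ℕ)) :
    Fintype.card {c : Cluster t n // c ≠ c₀ ∧ a ≤ (c.1 : ℕ)} <
      Fintype.card {c : Cluster t n // a ≤ (c.1 : ℕ)} := by
  refine Fintype.card_lt_of_injective_of_notMem (fun c => ⟨c.1, c.2.2⟩)
    (fun c d h => Subtype.ext (Subtype.mk.inj h)) (b := ⟨c₀, ha⟩) ?_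
  rintro ⟨c, hc⟩
  exact c.2.1 (Subtype.mk.inj hc)

/-- One cluster `c₀` is set aside and placed at a huge common rank `M`, with an extra threshold `2 *
M`; the others use `m` edge sums. -/
theorem isKThresholdGraph_clusterGraph_odd {m : ℕ} (hm : 0 < m)
    (h0 : 1 ≤ ∑ j ∈ Finset.Icc 3 t, n j) (h3 : ∑ j ∈ Finset.Icc 3 t, n j ≤ m + m.choose 3 + 1)
    (h4 : ∑ j ∈ Finset.Icc 4 t, n j ≤ m + 1) :
    IsKThresholdGraph (clusterGraph t n) (2 * m + 1) := by
  rw [← card_cluster_filter (by norm_num)] at h0 h3 h4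
  -- `c₀` has size at least 4 whenever possible, so that both counts of the remaining clusters fit.
  obtain ⟨c₀, hc3, hc4⟩ : ∃ c₀ : Cluster t n, 3 ≤ (c₀.1 : ℕ) ∧
      Fintype.card {c : Cluster t n // c ≠ c₀ ∧ 4 ≤ (c.1 : ℕ)} ≤ m := by
    by_cases h : ∃ c₀ : Cluster t n, 4 ≤ (c₀.1 : ℕ)
    · obtain ⟨c₀, hc⟩ := h
      have := card_ne_and_lt c₀ hc
      exact ⟨c₀, by omega, by omega⟩
    · obtain ⟨c₀⟩ := Fintype.card_pos_iff.1 h0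
      refine ⟨c₀, c₀.2, ?_⟩
      rw [Fintype.card_eq_zero_iff.2 ⟨fun c => h ⟨c.1, c.2.2⟩⟩]
      exact Nat.zero_le m
  have hlt := card_ne_and_lt c₀ hc3
  obtain ⟨S, r, rfl, h⟩ := exists_cluster_ranks hm (· ≠ c₀) (by omega) hc4
  obtain ⟨A, hA⟩ := (Set.finite_range fun p : ClusterVertex t n × ClusterVertex t n =>
    r p.1 + r p.2).bddAbove
  obtain ⟨B, hB⟩ := (Set.finite_range r).bddAbove
  obtain ⟨B', hB'⟩ := (Set.finite_range r).bddBelow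
  obtain ⟨C, hC⟩ := S.bddAbove
  have hA' : ∀ u v, r u + r v ≤ A := fun u v => hA ⟨(u, v), rfl⟩
  have hB1 : ∀ u, r u ≤ B := fun u => hB ⟨u, rfl⟩
  have hB2 : ∀ u, B' ≤ r u := fun u => hB' ⟨u, rfl⟩
  have hC' : ∀ s ∈ S, s ≤ C := fun s hs => hC hs
  -- The threshold `2 * M` exceeds `S` and all sums of old ranks, and every mixed sum `M + r u` lies
  -- strictly between `S` and `2 * M`.
  obtain ⟨M, hM⟩ : ∃ M : ℝ, A < 2 * M ∧ B < M ∧ C < M + B' ∧ C < 2 * M := by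
    refine ⟨|A| + |B| + |C| + |B'| + 1, ?_⟩
    have a1 := le_abs_self A
    have a2 := le_abs_self B
    have a3 := le_abs_self C
    have a4 := neg_abs_le B'
    have b1 := abs_nonneg A
    have b2 := abs_nonneg B
    have b3 := abs_nonneg C
    have b4 := abs_nonneg B'
    refine ⟨?_, ?_, ?_, ?_⟩ <;> linarith
  obtain ⟨hM1, hM2, hM3, hM4⟩ := hM
  have hmixed : ∀ u, ¬ (M + r u ∈ S ∨ 2 * M ≤ M + r u) := by
    rintro u (h | h)
    · linarith [hC' _ h, hB2 u]
    · linarith [hB1 u]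
  refine isKThresholdGraph_two_mul_add_one S (2 * M) (fun s hs => by linarith [hC' s hs])
    (fun u => if u.1 = c₀ then M else r u) fun u v huv => ?_
  rw [clusterGraph_adj_iff huv]
  by_cases hu : u.1 = c₀ <;> by_cases hv : v.1 = c₀
  · rw [if_pos hu, if_pos hv]
    exact iff_of_true (hu.trans hv.symm) (Or.inr (by linarith))
  · rw [if_pos hu, if_neg hv]
    exact iff_of_false (fun h => hv (h.symm.trans hu)) (hmixed v)
  · rw [if_neg hu, if_pos hv, add_comm]
    exact iff_of_false (fun h => hu (h.trans hv)) (hmixed u)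
  · rw [if_neg hu, if_neg hv, h u v huv hu hv, or_iff_left]
    linarith [hA' u v]

end ClusterGraph

/-! ### Computation of the threshold number -/

theorem thresholdNumber_eq {V : Type*} {G : SimpleGraph V} {k : ℕ} (h : IsKThresholdGraph G k)
    (h' : ∀ j, IsKThresholdGraph G j → k ≤ j) : thresholdNumber G = k :=
  le_antisymm (Nat.sInf_le h) (le_csInf ⟨k, h⟩ h')

theorem mainTheorem5 (t : ℕ) (n : ℕ → ℕ) (hn : 1 ≤ ∑ i ∈ Finset.Icc 1 t, n i) :
    (∑ j ∈ Finset.Icc 3 t, n j ≤ 1 →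
      (∑ k ∈ Finset.Icc 2 t, n k = 0 → thresholdNumber (clusterGraph t n) = 0) ∧
      (∑ k ∈ Finset.Icc 2 t, n k = 1 → thresholdNumber (clusterGraph t n) = 1) ∧
      (2 ≤ ∑ k ∈ Finset.Icc 2 t, n k → thresholdNumber (clusterGraph t n) = 2)) ∧
    (2 ≤ ∑ j ∈ Finset.Icc 3 t, n j →
      ∀ m : ℕ, 1 ≤ m → ∑ l ∈ Finset.Icc 4 t, n l ≤ m →
        (∑ j ∈ Finset.Icc 3 t, n j = qNum (m - 1) →
          thresholdNumber (clusterGraph t n) = 2 * m - 1) ∧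
        (qNum (m - 1) + 1 ≤ ∑ j ∈ Finset.Icc 3 t, n j →
          ∑ j ∈ Finset.Icc 3 t, n j ≤ qNum m - 1 →
          thresholdNumber (clusterGraph t n) = 2 * m)) := by
  have h43 : ∑ l ∈ Finset.Icc 4 t, n l ≤ ∑ j ∈ Finset.Icc 3 t, n j :=
    Finset.sum_le_sum_of_subset (Finset.Icc_subset_Icc_left (by norm_num))
  refine ⟨fun h3 => ⟨fun h2 => ?_, fun h2 => ?_, fun h2 => ?_⟩, fun h3 m hm h4 => ?_⟩
  · exact thresholdNumber_eq (isKThresholdGraph_zero h2) fun _ _ => Nat.zero_le _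
  · refine thresholdNumber_eq (isKThresholdGraph_one h2.le) fun j hj => ?_
    by_contra! hlt
    have := sum_le_one_of_isKThresholdGraph hj hlt.le
    omega
  · refine thresholdNumber_eq (isKThresholdGraph_clusterGraph_even one_pos (h3.trans (Nat.le_add_right _ _))
      (h43.trans h3)) fun j hj => ?_
    by_contra! hlt
    have := sum_le_one_of_isKThresholdGraph hj (Nat.le_of_lt_succ hlt)
    omega
  -- After the shift to `m + 1` the claimed values are `2 * m + 1` and `2 * (m + 1)`.
  · obtain ⟨m, rfl⟩ := Nat.exists_eq_add_of_le' hm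
    simp only [qNum, Nat.add_sub_cancel]
    refine ⟨fun h => ?_, fun h h' => ?_⟩
    -- For `m = 0` the sum would be `qNum 0 = 1`, but it is at least 2.
    · have hm0 : 0 < m := by
        rcases Nat.eq_zero_or_pos m with rfl | h0
        · simp at h
          omega
        · exact h0
      refine thresholdNumber_eq
        (isKThresholdGraph_clusterGraph_odd hm0 (by omega) h.le h4) fun j hj => ?_
      by_contra! hlt
      have := sum_le_of_isKThresholdGraph hj (m := m) (by omega)
      omega
    · refine thresholdNumber_eq
        (isKThresholdGraph_clusterGraph_even (Nat.succ_pos m) h' h4) fun j hj => ?_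
      by_contra! hlt
      have := sum_le_succ_of_isKThresholdGraph hj (m := m) (by omega)
      omega
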